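/- Theorem (Asymptotic linear rate). Let $n\ge 2$, let $H\in\mathbb{R}^{n\times n}$ be symmetric with smallest eigenvalue $\lambda_1<0$, let $g\in\mathbb{R}^n$, and let $f(z)=\tfrac12 z^\top Hz+g^\top z$. Assume the easy case: $g^\top v_1\neq 0$ for some eigenvector $v_1$ of $H$ with eigenvalue $\lambda_1$. Fix line search parameters $\bar\alpha>0$, $\beta\in(0,1)$, $\sigma\in(0,1)$. For $\|z\|=1$ write $p(z)=(I-zz^\top)(Hz+g)$ and $R_z(\alpha)=\frac{z-\alpha p(z)}{\|z-\alpha p(z)\|}$. Let $(z_t)_{t\ge 0}$ be a sequence in $\mathbb{R}^n$ which from some time $T$ on (phase II) consists of projected gradient iterates on the unit sphere with Armijo line search: for all $t\ge T$, $\|z_t\|=1$ and $z_{t+1}=R_{z_t}(\alpha_t)$, where $\alpha_t=\beta^{m}\bar\alpha$ and $m\ge 0$ is the smallest integer with $$f(z_t)-f\big(R_{z_t}(\beta^m\bar\alpha)\big)\ \ge\ \sigma\beta^m\bar\alpha\,\|p(z_t)\|^2 .$$ Suppose that $z_t\to z^*$ and that $z^*$ is a local minimizer of $f$ on the unit sphere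 (for instance, the global minimizer of $f$ on the unit ball). Then the Riemannian Hessian $\mathrm{Hess} f(z^*)$ of $f$ restricted to the unit sphere, a self-adjoint operator on the tangent space $\{\xi:\xi^\top z^*=0\}$, is positive definite. Let $\lambda_{\min}>0$ and $\lambda_{\max}$ be its smallest and largest eigenvalues. If $z^*$ is a global minimizer of $f$ on the unit ball, then there is $\lambda\ge0$ with $(H+\lambda I)z^*+g=0$ and $\lambda_{\min}\ge\lambda+\lambda_1>0$. Moreover, for every $r\in(r_*,1)$, where $$r_*=1-\min\Big(2\sigma\bar\alpha\lambda_{\min},\ 4\sigma(1-\sigma)\beta\,\frac{\lambda_{\min}}{\lambda_{\max}}\Big),$$ there is an integer $K$ such that $f(z_{t+1})-f(z^*)\le r\,\big(f(z_t)-f(z^*)\big)$ for all $t\ge K$. -/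

import Mathlib

open Filter Topology
open scoped RealInnerProductSpace Gradient

namespace TrustRegion

noncomputable section

/-! ### Riemannian Hessian on the unit sphere -/

section Sphere

variable {E : Type*} [NormedAddCommGroup E] [InnerProductSpace ℝ E]

/-- The tangent space at `x` of the unit sphere: the orthogonal complement of `x`. -/
abbrev tangent (x : E) : Submodule ℝ E := (ℝ ∙ x)ᗮ

/-- The vector field `y ↦ (I - y yᵀ) ∇f(y)`; on the unit sphere this is the Riemannian gradient
of the restriction of `f` to the sphere. -/
def sphereGrad [CompleteSpace E] (f : E → ℝ) (y : E) : E := ∇ f y - ⟪y, ∇ f y⟫ • y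

/-- The Riemannian Hessian at `x` of the restriction of `f` to the unit sphere, as a linear
operator on the tangent space: the covariant derivative `ξ ↦ ∇_ξ grad f` of the Riemannian
gradient. The Levi-Civita connection of the sphere, as a Riemannian submanifold of `E`, is the
directional derivative in `E` followed by orthogonal projection onto the tangent space. -/
def sphereHess [CompleteSpace E] (f : E → ℝ) (x : E) : tangent x →L[ℝ] tangent x :=
  (tangent x).orthogonalProjectionOnto ∘L fderiv ℝ (sphereGrad f) x ∘L (tangent x).subtypeL

/-- The exponential map of the unit sphere: `Exp_x ξ = cos ‖ξ‖ x + (sin ‖ξ‖ / ‖ξ‖) ξ`. -/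
def sphereExp (x ξ : E) : E := Real.cos ‖ξ‖ • x + Real.sinc ‖ξ‖ • ξ

/-- Agreement with the other usual description of the Riemannian Hessian: its quadratic form is
the second derivative of `f` along geodesics, `⟪Hess f(x)[ξ], ξ⟫ = d²/dt² f(Exp_x(tξ))` at
`t = 0`. -/
theorem inner_sphereHess_self [CompleteSpace E] {f : E → ℝ} (hf : ContDiff ℝ 2 f) {x : E}
    (ξ : tangent x) :
    ⟪sphereHess f x ξ, ξ⟫ = deriv (deriv fun t : ℝ => f (sphereExp x (t • (ξ : E)))) 0 := by
  have hgrad : ContDiff ℝ 1 (∇ f) := by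
    have h : ∇ f = fun y => (InnerProductSpace.toDual ℝ E).symm (fderiv ℝ f y) := rfl
    rw [h]
    exact (InnerProductSpace.toDual ℝ E).symm.contDiff.comp (hf.fderiv_right le_rfl)
  have hG (y : E) : HasFDerivAt (∇ f) (fderiv ℝ (∇ f) y) y :=
    (hgrad.differentiable one_ne_zero y).hasFDerivAt
  have hxξ : ⟪x, (ξ : E)⟫ = 0 := (Submodule.mem_orthogonal_singleton_iff_inner_right).1 ξ.2
  -- the left hand side
  have hL : ⟪sphereHess f x ξ, ξ⟫
      = ⟪fderiv ℝ (∇ f) x ξ, (ξ : E)⟫ - ⟪x, ∇ f x⟫ * ‖(ξ : E)‖ ^ 2 := by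
    have h1 : HasFDerivAt (sphereGrad f) _ x :=
      (hG x).sub (((hasFDerivAt_id x).inner ℝ (hG x)).smul (hasFDerivAt_id x))
    have h2 : ⟪sphereHess f x ξ, ξ⟫ = ⟪fderiv ℝ (sphereGrad f) x ξ, (ξ : E)⟫ := by
      simp [sphereHess]
    rw [h2, h1.fderiv]
    simp [inner_sub_left, inner_add_left, inner_smul_left, hxξ]
  -- the geodesic
  set s : ℝ := ‖(ξ : E)‖ with hs
  have hγ (t : ℝ) : sphereExp x (t • (ξ : E)) = Real.cos (t * s) • x + (t * Real.sinc (t * s)) • (ξ : E) := by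
    have h : ‖t • (ξ : E)‖ = |t * s| := by
      rw [norm_smul, Real.norm_eq_abs, abs_mul, abs_of_nonneg (norm_nonneg (ξ : E))]
    have h2 : Real.sinc |t * s| = Real.sinc (t * s) := by
      rcases abs_choice (t * s) with h | h <;> rw [h]
      exact Real.sinc_neg _
    rw [sphereExp, h, Real.cos_abs, h2, smul_smul, mul_comm (Real.sinc _)]
  have hγ' (t : ℝ) : HasDerivAt (fun t : ℝ => sphereExp x (t • (ξ : E)))
      ((-(Real.sin (t * s) * s)) • x + Real.cos (t * s) • (ξ : E)) t := by
    have hlin : HasDerivAt (fun t : ℝ => t * s) s t := by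
      simpa using (hasDerivAt_id t).mul_const s
    have hsin : HasDerivAt (fun t : ℝ => t * Real.sinc (t * s)) (Real.cos (t * s)) t := by
      by_cases h0 : s = 0
      · simpa [h0] using hasDerivAt_id' t
      · have h1 : (fun t : ℝ => t * Real.sinc (t * s)) = fun t => Real.sin (t * s) / s := by
          funext u
          by_cases hu : u = 0
          · simp [hu]
          · rw [Real.sinc_of_ne_zero (mul_ne_zero hu h0)]
            field_simp
        rw [h1]
        have h2 := hlin.sin.div_const s
        rwa [mul_div_assoc, div_self h0, mul_one] at h2
    have h3 := (hlin.cos.smul_const x).add (hsin.smul_const (ξ : E))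
    refine (h3.congr_of_eventuallyEq (Eventually.of_forall hγ)).congr_deriv ?_
    simp
  have hd : (deriv fun t : ℝ => f (sphereExp x (t • (ξ : E)))) = fun t : ℝ =>
      ⟪∇ f (sphereExp x (t • (ξ : E))),
        (-(Real.sin (t * s) * s)) • x + Real.cos (t * s) • (ξ : E)⟫ := by
    funext t
    have hfd := ((hf.differentiable two_ne_zero
      (sphereExp x (t • (ξ : E)))).hasGradientAt.hasFDerivAt).comp_hasDerivAt t (hγ' t)
    exact hfd.deriv
  have h0 : sphereExp x ((0 : ℝ) • (ξ : E)) = x := by simp [sphereExp]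
  have hvel : HasDerivAt (fun t : ℝ => (-(Real.sin (t * s) * s)) • x + Real.cos (t * s) • (ξ : E))
      ((-(s ^ 2)) • x) 0 := by
    have hlin : HasDerivAt (fun t : ℝ => t * s) s 0 := by
      simpa using (hasDerivAt_id (0 : ℝ)).mul_const s
    have h3 := (((hlin.sin.mul_const s).neg).smul_const x).add (hlin.cos.smul_const (ξ : E))
    refine h3.congr_deriv ?_
    simp [pow_two]
  have hg0 : HasDerivAt (fun t : ℝ => ∇ f (sphereExp x (t • (ξ : E))))
      (fderiv ℝ (∇ f) x ξ) 0 := by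
    have h1 := hγ' 0
    have h2 : HasFDerivAt (∇ f) (fderiv ℝ (∇ f) x) (sphereExp x ((0 : ℝ) • (ξ : E))) := by
      rw [h0]; exact hG x
    have h3 := h2.comp_hasDerivAt (0 : ℝ) h1
    refine h3.congr_deriv ?_
    simp
  rw [hL, hd, (hg0.inner ℝ hvel).deriv, h0]
  simp [inner_smul_right, real_inner_comm x]
  ring

end Sphere

/-! ### The trust region problem and the line search projected gradient method -/

section Algorithm

variable {n : ℕ}

/-- `f(z) = ½ zᵀ H z + gᵀ z`. -/
def objective (H : Matrix (Fin n) (Fin n) ℝ) (g z : EuclideanSpace ℝ (Fin n)) : ℝ :=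
  1 / 2 * ⟪z, H.toEuclideanLin z⟫ + ⟪g, z⟫

/-- The projected gradient `(I - z zᵀ)(H z + g)`. -/
def projGrad (H : Matrix (Fin n) (Fin n) ℝ) (g z : EuclideanSpace ℝ (Fin n)) :
    EuclideanSpace ℝ (Fin n) :=
  (H.toEuclideanLin z + g) - ⟪z, H.toEuclideanLin z + g⟫ • z

/-- The trial point of the projected gradient step on the sphere with step size `α`:
`(z - α (I - z zᵀ)(H z + g)) / ‖z - α (I - z zᵀ)(H z + g)‖`. -/
def trialPoint (H : Matrix (Fin n) (Fin n) ℝ) (g z : EuclideanSpace ℝ (Fin n)) (α : ℝ) :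
    EuclideanSpace ℝ (Fin n) :=
  ‖z - α • projGrad H g z‖⁻¹ • (z - α • projGrad H g z)

/-- Armijo's sufficient decrease condition for the step size `α`, with parameter `σ`:
`f(z) - f(trial point) ≥ σ α ‖(I - z zᵀ)(H z + g)‖²`. -/
def SufficientDecrease (H : Matrix (Fin n) (Fin n) ℝ) (g : EuclideanSpace ℝ (Fin n)) (σ : ℝ)
    (z : EuclideanSpace ℝ (Fin n)) (α : ℝ) : Prop :=
  σ * α * ‖projGrad H g z‖ ^ 2 ≤ objective H g z - objective H g (trialPoint H g z α)

/-- `α` is the step size chosen at `z` by Armijo backtracking with initial step size `αbar`,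
contraction factor `β` and sufficient decrease parameter `σ`: `α = β ^ m * αbar` for the smallest
natural number `m` for which the sufficient decrease condition holds. -/
def IsArmijoStep (H : Matrix (Fin n) (Fin n) ℝ) (g : EuclideanSpace ℝ (Fin n)) (αbar β σ : ℝ)
    (z : EuclideanSpace ℝ (Fin n)) (α : ℝ) : Prop :=
  ∃ m : ℕ, α = β ^ m * αbar ∧
    IsLeast {k : ℕ | SufficientDecrease H g σ z (β ^ k * αbar)} m

/-- From time `T` on, the sequence `z` is in phase II: its terms lie on the unit sphere and each
one arises from its predecessor by a projected gradient step with Armijo line search. -/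
def IsPhaseTwo (H : Matrix (Fin n) (Fin n) ℝ) (g : EuclideanSpace ℝ (Fin n)) (αbar β σ : ℝ)
    (T : ℕ) (z : ℕ → EuclideanSpace ℝ (Fin n)) : Prop :=
  ∀ t ≥ T, ‖z t‖ = 1 ∧
    ∃ α : ℝ, IsArmijoStep H g αbar β σ (z t) α ∧ z (t + 1) = trialPoint H g (z t) α

end Algorithm

/-- The set of (real) eigenvalues of an endomorphism of a real vector space. -/
def eigenvalueSet {V : Type*} [AddCommGroup V] [Module ℝ V] (A : V →ₗ[ℝ] V) : Set ℝ :=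
  {μ | Module.End.HasEigenvalue A μ}

end

end TrustRegion

/-! Everything rests on one exact identity. With `A = shifted H g z`, the matrix `H` minus the
multiplier at `z`, points `z`, `w` of the sphere satisfy f(w) - f(z) = ⟪p(z), w - z⟫ + ½⟪w - z, A(w
- z)⟫, because ⟪z, w - z⟫ = -½‖w - z‖². Restricted to the tangent space, `A` is the Riemannian
Hessian (`inner_sphereHess`).

Positive definiteness (`inner_shifted_pos`): at a local minimizer the conditions of order one to
three along great circles place any degenerate tangent direction η in the kernel of `A`. In the easy
case v₁ is an eigenvector of `A` with nonzero eigenvalue k. If k > 0, the Rayleigh quotient of `H`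
at η falls below λ₁; if k < 0, a curve leaving along η and bending towards v₁ lowers f. Both are
absurd.

Rate: near the limit ‖p‖² is at least about 2 λ_min times the gap
(`eventually_gap_le_sq_norm_projGrad`), and a step α obeys a descent inequality with constant about
λ_max (`eventually_descent`), so backtracking keeps α at least about min(ᾱ, 2(1-σ)β/λ_max)
(`IsArmijoStep.min_le`). The decrease σα‖p‖² is then at least (1 - r) times the gap. The losses
hidden in "about" fit into the strict inequality r > r_*. -/

namespace TrustRegion

/-! ### Extreme eigenvalues, and quadratic forms near a hyperplane -/

section General

variable {V : Type*} [NormedAddCommGroup V] [InnerProductSpace ℝ V]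

theorem isLeast_eigenvalueSet_of_forall_le {B : V →ₗ[ℝ] V} {m : ℝ} (hm : m ∈ eigenvalueSet B)
    (h : ∀ x, m * ‖x‖ ^ 2 ≤ ⟪B x, x⟫) : IsLeast (eigenvalueSet B) m := by
  refine ⟨hm, fun k hk => ?_⟩
  obtain ⟨x, hx⟩ := Module.End.HasEigenvalue.exists_hasEigenvector hk
  have h1 := h x
  rw [hx.apply_eq_smul, real_inner_smul_left, real_inner_self_eq_norm_sq] at h1
  have h2 : 0 < ‖x‖ ^ 2 := pow_pos (norm_pos_iff.2 hx.2) 2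
  exact le_of_mul_le_mul_right h1 h2

variable [FiniteDimensional ℝ V]

theorem exists_isLeast_eigenvalueSet [Nontrivial V] {B : V →ₗ[ℝ] V} (hB : B.IsSymmetric) :
    ∃ m, IsLeast (eigenvalueSet B) m ∧ ∀ x, m * ‖x‖ ^ 2 ≤ ⟪B x, x⟫ := by
  have h := hB.hasEigenvalue_iInf_of_finiteDimensional
  set m := ⨅ x : { x : V // x ≠ 0 }, RCLike.re ⟪B x, x⟫ / ‖(x : V)‖ ^ 2 with hm
  have hbd : BddBelow (Set.range fun x : { x : V // x ≠ 0 } =>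
      RCLike.re ⟪B x, x⟫ / ‖(x : V)‖ ^ 2) := by
    refine ⟨-‖B.toContinuousLinearMap‖, ?_⟩
    rintro _ ⟨x, rfl⟩
    have hx : 0 < ‖(x : V)‖ ^ 2 := pow_pos (norm_pos_iff.2 x.2) 2
    rw [le_div_iff₀ hx]
    have h1 := abs_le.1 (abs_real_inner_le_norm (B x) (x : V))
    have h2 : ‖B x‖ ≤ ‖B.toContinuousLinearMap‖ * ‖(x : V)‖ :=
      B.toContinuousLinearMap.le_opNorm x
    have h3 := mul_le_mul_of_nonneg_right h2 (norm_nonneg (x : V))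
    simp only [RCLike.re_to_real]
    nlinarith [h1.1]
  have hle : ∀ x, m * ‖x‖ ^ 2 ≤ ⟪B x, x⟫ := by
    intro x
    by_cases hx : x = 0
    · simp [hx]
    · have hx2 : 0 < ‖x‖ ^ 2 := pow_pos (norm_pos_iff.2 hx) 2
      rw [← le_div_iff₀ hx2]
      exact ciInf_le hbd ⟨x, hx⟩
  exact ⟨m, isLeast_eigenvalueSet_of_forall_le h hle, hle⟩

theorem exists_isGreatest_eigenvalueSet [Nontrivial V] {B : V →ₗ[ℝ] V} (hB : B.IsSymmetric) :
    ∃ m, IsGreatest (eigenvalueSet B) m ∧ ∀ x, ⟪B x, x⟫ ≤ m * ‖x‖ ^ 2 := by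
  have hneg : ∀ k, k ∈ eigenvalueSet B ↔ -k ∈ eigenvalueSet (-B) := by
    intro k
    simp only [eigenvalueSet, Set.mem_ofPred_eq]
    constructor <;> intro h <;> obtain ⟨x, hx⟩ := h.exists_hasEigenvector <;>
      refine Module.End.hasEigenvalue_of_hasEigenvector (x := x)
        (Module.End.hasEigenvector_iff.2 ⟨Module.End.mem_eigenspace_iff.2 ?_, hx.2⟩)
    · simp [hx.apply_eq_smul]
    · have := hx.apply_eq_smul
      simpa using this
  have hB' : (-B).IsSymmetric := fun x y => by
    simpa using hB x y
  obtain ⟨m, hm, hle⟩ := exists_isLeast_eigenvalueSet hB'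
  refine ⟨-m, ⟨(hneg _).2 (by simpa using hm.1), fun k hk => ?_⟩, fun x => ?_⟩
  · linarith [hm.2 ((hneg k).1 hk)]
  · have := hle x
    simp only [LinearMap.neg_apply, inner_neg_left] at this
    linarith

/-- An upper bound of a quadratic form on a hyperplane persists, up to an arbitrarily small loss,
on a cone around the hyperplane. -/
theorem exists_cone_inner_le (A : V →ₗ[ℝ] V) {u : V} (hu : ‖u‖ = 1) {a b : ℝ} (hab : a < b)
    (h : ∀ x, ⟪x, u⟫ = 0 → ⟪x, A x⟫ ≤ a * ‖x‖ ^ 2) :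
    ∃ δ > 0, ∀ v, |⟪v, u⟫| ≤ δ * ‖v‖ → ⟪v, A v⟫ ≤ b * ‖v‖ ^ 2 := by
  set M := ‖A.toContinuousLinearMap‖ with hM
  have hM0 : 0 ≤ M := norm_nonneg _
  have hA : ∀ x, ‖A x‖ ≤ M * ‖x‖ := A.toContinuousLinearMap.le_opNorm
  -- Total error per unit of `δ * ‖v‖ ^ 2`: each of the two cross terms costs `M`, replacing `‖x‖ ^
  -- 2` by `‖v‖ ^ 2` costs `|a|`, and the 1 keeps `K` positive.
  set K := 2 * M + |a| + 1 with hK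
  have hK0 : 0 < K := by positivity
  refine ⟨min 1 ((b - a) / K), lt_min one_pos (div_pos (sub_pos.2 hab) hK0), fun v hv => ?_⟩
  set δ := min 1 ((b - a) / K) with hδ
  have hδ0 : 0 < δ := lt_min one_pos (div_pos (sub_pos.2 hab) hK0)
  have hδ1 : δ ≤ 1 := min_le_left _ _
  have hδK : δ * K ≤ b - a := (le_div_iff₀ hK0).1 (min_le_right _ _)
  set c := ⟪v, u⟫ with hc
  set x := v - c • u with hx
  have huu : ⟪u, u⟫ = 1 := by rw [real_inner_self_eq_norm_sq, hu]; norm_num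
  have hxu : ⟪x, u⟫ = 0 := by
    rw [hx, inner_sub_left, real_inner_smul_left, huu, ← hc]; ring
  have hvx : v = x + c • u := by rw [hx]; abel
  have hn : ‖v‖ ^ 2 = ‖x‖ ^ 2 + c ^ 2 := by
    rw [hvx, norm_add_sq_real, real_inner_smul_right, hxu, norm_smul, hu, Real.norm_eq_abs,
      mul_one, sq_abs]
    ring
  have hxv : ‖x‖ ≤ ‖v‖ := by
    apply (sq_le_sq₀ (norm_nonneg x) (norm_nonneg v)).1
    nlinarith [sq_nonneg c]
  have hexp : ⟪v, A v⟫ = ⟪x, A x⟫ + c * ⟪x, A u⟫ + c * ⟪u, A v⟫ := by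
    have hAv : A v = A x + c • A u := by rw [← map_smul, ← map_add, ← hvx]
    have h1 : ⟪v, A v⟫ = ⟪x, A v⟫ + c * ⟪u, A v⟫ := by
      rw [← real_inner_smul_left, ← inner_add_left, ← hvx]
    have h2 : ⟪x, A v⟫ = ⟪x, A x⟫ + c * ⟪x, A u⟫ := by
      rw [hAv, inner_add_right, real_inner_smul_right]
    rw [h1, h2]

  have h1 : c * ⟪x, A u⟫ ≤ δ * ‖v‖ * (M * ‖v‖) := by
    refine (le_abs_self _).trans ?_
    rw [abs_mul]
    refine mul_le_mul hv ?_ (abs_nonneg _) (by positivity)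
    refine (abs_real_inner_le_norm _ _).trans ?_
    have := hA u
    rw [hu, mul_one] at this
    rw [mul_comm M]
    exact mul_le_mul hxv this (norm_nonneg _) (norm_nonneg _)
  have h2 : c * ⟪u, A v⟫ ≤ δ * ‖v‖ * (M * ‖v‖) := by
    refine (le_abs_self _).trans ?_
    rw [abs_mul]
    refine mul_le_mul hv ?_ (abs_nonneg _) (by positivity)
    refine (abs_real_inner_le_norm _ _).trans ?_
    rw [hu, one_mul]
    exact hA v
  have h3 : c ^ 2 ≤ δ * ‖v‖ ^ 2 := by
    have : c ^ 2 ≤ (δ * ‖v‖) ^ 2 := by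
      rw [← sq_abs]; exact pow_le_pow_left₀ (abs_nonneg _) hv 2
    have h4 : δ ^ 2 ≤ δ := by nlinarith
    nlinarith [sq_nonneg ‖v‖]
  have h4 : a * ‖x‖ ^ 2 ≤ a * ‖v‖ ^ 2 + |a| * (δ * ‖v‖ ^ 2) := by
    have h5 : -a * c ^ 2 ≤ |a| * (δ * ‖v‖ ^ 2) :=
      (mul_le_mul_of_nonneg_right (neg_le_abs a) (sq_nonneg c)).trans
        (mul_le_mul_of_nonneg_left h3 (abs_nonneg a))
    rw [hn] at h5 ⊢
    linarith
  have h5 := h x hxu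
  have h6 : δ * K * ‖v‖ ^ 2 ≤ (b - a) * ‖v‖ ^ 2 :=
    mul_le_mul_of_nonneg_right hδK (sq_nonneg _)
  have h7 : 0 ≤ δ * ‖v‖ ^ 2 := by positivity
  rw [hexp]
  rw [hK] at h6
  nlinarith

theorem exists_cone_le_inner (A : V →ₗ[ℝ] V) {u : V} (hu : ‖u‖ = 1) {a b : ℝ} (hab : b < a)
    (h : ∀ x, ⟪x, u⟫ = 0 → a * ‖x‖ ^ 2 ≤ ⟪x, A x⟫) :
    ∃ δ > 0, ∀ v, |⟪v, u⟫| ≤ δ * ‖v‖ → b * ‖v‖ ^ 2 ≤ ⟪v, A v⟫ := by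
  obtain ⟨δ, hδ, H⟩ := exists_cone_inner_le (-A) hu (neg_lt_neg hab) (fun x hx => by
    have := h x hx
    simp only [LinearMap.neg_apply, inner_neg_right]
    linarith)
  refine ⟨δ, hδ, fun v hv => ?_⟩
  have := H v hv
  simp only [LinearMap.neg_apply, inner_neg_right] at this
  linarith

end General

/-! ### Signs of leading coefficients at zero -/

section Germs

theorem nonneg_of_eventually_sq_mul_nonneg {h : ℝ → ℝ} (hc : Continuous h)
    (H : ∀ᶠ x in 𝓝 (0 : ℝ), 0 ≤ x ^ 2 * h x) : 0 ≤ h 0 := by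
  by_contra! hneg
  have h1 : ∀ᶠ x in 𝓝 (0 : ℝ), h x < 0 := hc.continuousAt.eventually_lt continuousAt_const hneg
  have h2 : ∀ᶠ x in 𝓝[>] (0 : ℝ), (0 ≤ x ^ 2 * h x ∧ h x < 0) ∧ 0 < x :=
    ((H.and h1).filter_mono nhdsWithin_le_nhds).and self_mem_nhdsWithin
  obtain ⟨x, ⟨hx1, hx2⟩, hx3⟩ := h2.exists
  nlinarith [pow_pos hx3 2]

theorem eq_zero_of_eventually_mul_nonneg {h : ℝ → ℝ} (hc : Continuous h)
    (H : ∀ᶠ x in 𝓝 (0 : ℝ), 0 ≤ x * h x) : h 0 = 0 := by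
  have key : ∀ {k : ℝ → ℝ}, Continuous k → (∀ᶠ x in 𝓝 (0 : ℝ), 0 ≤ x * k x) → 0 ≤ k 0 := by
    intro k hk Hk
    by_contra! hneg
    have h1 : ∀ᶠ x in 𝓝 (0 : ℝ), k x < 0 :=
      hk.continuousAt.eventually_lt continuousAt_const hneg
    have h2 : ∀ᶠ x in 𝓝[>] (0 : ℝ), (0 ≤ x * k x ∧ k x < 0) ∧ 0 < x :=
      ((Hk.and h1).filter_mono nhdsWithin_le_nhds).and self_mem_nhdsWithin
    obtain ⟨x, ⟨hx1, hx2⟩, hx3⟩ := h2.exists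
    nlinarith
  refine le_antisymm ?_ (key hc H)
  have h0 : Tendsto (fun x : ℝ => -x) (𝓝 0) (𝓝 0) := by
    simpa using (continuous_neg (G := ℝ)).tendsto 0
  have := key (k := fun x => -h (-x)) (by fun_prop) ((h0.eventually H).mono fun x hx => by
    linarith)
  simpa using this

end Germs

end TrustRegion
namespace TrustRegion

/-! ### Optimality conditions on the sphere and on the ball -/

section Objective

variable {n : ℕ} {H : Matrix (Fin n) (Fin n) ℝ} {g : EuclideanSpace ℝ (Fin n)}

theorem isSymmetric_toEuclideanLin (hH : H.IsSymm) : H.toEuclideanLin.IsSymmetric := by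
  apply Matrix.isSymmetric_toEuclideanLin_iff.2
  rw [Matrix.IsHermitian, Matrix.conjTranspose_eq_transpose_of_trivial]
  exact hH

/-- `H` shifted by the multiplier at `z`: the Hessian at `z` of the Lagrangian. -/
noncomputable def shifted (H : Matrix (Fin n) (Fin n) ℝ) (g z : EuclideanSpace ℝ (Fin n)) :
    EuclideanSpace ℝ (Fin n) →ₗ[ℝ] EuclideanSpace ℝ (Fin n) :=
  H.toEuclideanLin - ⟪z, H.toEuclideanLin z + g⟫ • LinearMap.id

theorem shifted_apply (z x : EuclideanSpace ℝ (Fin n)) :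
    shifted H g z x = H.toEuclideanLin x - ⟪z, H.toEuclideanLin z + g⟫ • x := rfl

theorem isSymmetric_shifted (hH : H.IsSymm) (z : EuclideanSpace ℝ (Fin n)) :
    (shifted H g z).IsSymmetric := fun x y => by
  have := isSymmetric_toEuclideanLin hH x y
  simp only [shifted_apply, inner_sub_left, inner_sub_right, real_inner_smul_left,
    real_inner_smul_right, this]

theorem inner_self_eq_one {z : EuclideanSpace ℝ (Fin n)} (hz : ‖z‖ = 1) : ⟪z, z⟫ = 1 := by
  rw [real_inner_self_eq_norm_sq, hz, one_pow]

theorem inner_projGrad_self {z : EuclideanSpace ℝ (Fin n)} (hz : ‖z‖ = 1) :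
    ⟪projGrad H g z, z⟫ = 0 := by
  rw [projGrad, inner_sub_left, real_inner_smul_left, inner_self_eq_one hz, real_inner_comm]
  ring

theorem objective_add (hH : H.IsSymm) (z d : EuclideanSpace ℝ (Fin n)) :
    objective H g (z + d) = objective H g z + ⟪H.toEuclideanLin z + g, d⟫
      + 1 / 2 * ⟪d, H.toEuclideanLin d⟫ := by
  have h1 := isSymmetric_toEuclideanLin hH z d
  simp only [objective, map_add, inner_add_left, inner_add_right]
  rw [h1, real_inner_comm (H.toEuclideanLin z) d, h1]
  ring

theorem inner_self_sub_of_norm_eq_one {z w : EuclideanSpace ℝ (Fin n)} (hz : ‖z‖ = 1)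
    (hw : ‖w‖ = 1) : ⟪z, w - z⟫ = -(1 / 2) * ‖w - z‖ ^ 2 := by
  rw [norm_sub_sq_real, hz, hw, inner_sub_right, inner_self_eq_one hz, real_inner_comm]
  ring

/-- The normal component of the gradient pairs with `w - z` to a multiple of `‖w - z‖ ^ 2`, hence
moves into the quadratic term without any remainder. -/
theorem objective_sub_of_norm_eq_one (hH : H.IsSymm) {z w : EuclideanSpace ℝ (Fin n)}
    (hz : ‖z‖ = 1) (hw : ‖w‖ = 1) :
    objective H g w - objective H g z
      = ⟪projGrad H g z, w - z⟫ + 1 / 2 * ⟪w - z, shifted H g z (w - z)⟫ := by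
  have h := objective_add (g := g) hH z (w - z)
  have h2 := inner_self_sub_of_norm_eq_one hz hw
  rw [add_sub_cancel] at h
  generalize w - z = d at h h2 ⊢
  rw [h, shifted_apply, projGrad, inner_sub_left, inner_sub_right, real_inner_smul_left,
    real_inner_smul_right, real_inner_self_eq_norm_sq, h2]
  ring

theorem shifted_self {z : EuclideanSpace ℝ (Fin n)} (hp : projGrad H g z = 0) :
    shifted H g z z = -g := by
  rw [projGrad] at hp
  rw [shifted_apply, eq_neg_iff_add_eq_zero, ← hp]
  abel

theorem eventually_curve_nonneg (hH : H.IsSymm) {zs ξ : EuclideanSpace ℝ (Fin n)}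
    (hzs : IsLocalMinOn (objective H g) (Metric.sphere 0 1) zs) (hn : ‖zs‖ = 1) (hξ : ‖ξ‖ = 1)
    (ho : ⟪ξ, zs⟫ = 0) :
    ∀ᶠ x in 𝓝 (0 : ℝ), 0 ≤ x * (⟪projGrad H g zs, ξ⟫ * (1 + x ^ 2)
      + x * (⟪ξ, shifted H g zs ξ⟫
        + x * (-2 * ⟪zs, shifted H g zs ξ⟫ + x * ⟪zs, shifted H g zs zs⟫))) := by
  -- Stereographic parametrization ((1 - x²) zs + 2x ξ) / (1 + x²) of the great circle through `zs`
  -- and `ξ`. Being rational, it turns the increment of the objective into a polynomial once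
  -- multiplied by (1 + x²)² / 2.
  set w : ℝ → EuclideanSpace ℝ (Fin n) :=
    fun x => zs + (2 * x / (1 + x ^ 2)) • (ξ - x • zs) with hw
  have hcont : Continuous w := by
    have : Continuous fun x : ℝ => 2 * x / (1 + x ^ 2) :=
      Continuous.div (by fun_prop) (by fun_prop) (fun x => by positivity)
    fun_prop
  have h0 : w 0 = zs := by simp [hw]
  have hnorm : ∀ x, ‖w x‖ = 1 := by
    intro x
    have hx : (1 + x ^ 2) ≠ 0 := by positivity
    have h1 : ‖ξ - x • zs‖ ^ 2 = 1 + x ^ 2 := by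
      rw [norm_sub_sq_real, real_inner_smul_right, ho, norm_smul, hξ, hn, mul_one,
        Real.norm_eq_abs, sq_abs]
      ring
    have h2 : ⟪zs, ξ - x • zs⟫ = -x := by
      rw [inner_sub_right, real_inner_smul_right, inner_self_eq_one hn, real_inner_comm, ho]
      ring
    have h3 : ‖w x‖ ^ 2 = 1 := by
      simp only [hw]
      rw [norm_add_sq_real, real_inner_smul_right, h2, norm_smul, mul_pow, h1, hn,
        Real.norm_eq_abs, sq_abs]
      field_simp
      ring
    exact (pow_eq_one_iff_of_nonneg (norm_nonneg _) two_ne_zero).1 h3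
  have ht : Tendsto w (𝓝 0) (𝓝[Metric.sphere 0 1] zs) := by
    refine tendsto_nhdsWithin_iff.2 ⟨h0 ▸ hcont.tendsto 0, Eventually.of_forall fun x => ?_⟩
    simpa using hnorm x
  filter_upwards [ht.eventually hzs] with x hx
  have h1 := objective_sub_of_norm_eq_one (g := g) hH hn (hnorm x)
  have h2 : w x - zs = (2 * x / (1 + x ^ 2)) • (ξ - x • zs) := by simp [hw]
  have h3 := isSymmetric_shifted (g := g) hH zs zs ξ
  rw [real_inner_comm] at h3
  rw [h2, map_smul, map_sub, map_smul] at h1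
  simp only [real_inner_smul_left, real_inner_smul_right, inner_sub_left, inner_sub_right,
    inner_projGrad_self hn, h3] at h1
  have h4 : 0 < 1 + x ^ 2 := by positivity
  have h5 : 0 ≤ (objective H g (w x) - objective H g zs) * ((1 + x ^ 2) ^ 2 / 2) :=
    mul_nonneg (sub_nonneg.2 hx) (by positivity)
  rw [h1] at h5
  refine h5.trans_eq ?_
  field_simp
  ring

/-- These are the coefficients of x, x² and x³ along the great circle. A leading odd coefficient
must vanish since x takes both signs; a leading even one is nonnegative. -/
theorem localMin_conditions_of_unit (hH : H.IsSymm) {zs ξ : EuclideanSpace ℝ (Fin n)}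
    (hzs : IsLocalMinOn (objective H g) (Metric.sphere 0 1) zs) (hn : ‖zs‖ = 1) (hξ : ‖ξ‖ = 1)
    (ho : ⟪ξ, zs⟫ = 0) :
    ⟪projGrad H g zs, ξ⟫ = 0 ∧ 0 ≤ ⟪ξ, shifted H g zs ξ⟫ ∧
      (⟪ξ, shifted H g zs ξ⟫ = 0 → ⟪zs, shifted H g zs ξ⟫ = 0) := by
  have h := eventually_curve_nonneg hH hzs hn hξ ho
  have h1 : ⟪projGrad H g zs, ξ⟫ = 0 := by
    simpa using eq_zero_of_eventually_mul_nonneg (by fun_prop) h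
  refine ⟨h1, ?_, fun h2 => ?_⟩
  · have := nonneg_of_eventually_sq_mul_nonneg (h := fun x => ⟪ξ, shifted H g zs ξ⟫
        + x * (-2 * ⟪zs, shifted H g zs ξ⟫ + x * ⟪zs, shifted H g zs zs⟫)) (by fun_prop)
      (h.mono fun x hx => by rw [h1] at hx; linarith)
    simpa using this
  · have h3 : ∀ᶠ x in 𝓝 (0 : ℝ),
        0 ≤ x * (-2 * ⟪zs, shifted H g zs ξ⟫ + x * ⟪zs, shifted H g zs zs⟫) := by
      have h4 : ∀ᶠ x in 𝓝[≠] (0 : ℝ),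
          0 ≤ x * (-2 * ⟪zs, shifted H g zs ξ⟫ + x * ⟪zs, shifted H g zs zs⟫) := by
        filter_upwards [h.filter_mono nhdsWithin_le_nhds, self_mem_nhdsWithin] with x hx hx0
        rw [h1, h2] at hx
        have h5 : 0 < x ^ 2 := sq_pos_of_ne_zero hx0
        exact nonneg_of_mul_nonneg_right (a := x ^ 2) (by linarith) h5
      rw [eventually_nhdsWithin_iff] at h4
      filter_upwards [h4] with x hx
      by_cases hx0 : x = 0
      · simp [hx0]
      · exact hx hx0
    have h4 := eq_zero_of_eventually_mul_nonneg (by fun_prop) h3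
    linarith

theorem projGrad_eq_zero_of_isLocalMinOn (hH : H.IsSymm) {zs : EuclideanSpace ℝ (Fin n)}
    (hzs : IsLocalMinOn (objective H g) (Metric.sphere 0 1) zs) (hn : ‖zs‖ = 1) :
    projGrad H g zs = 0 := by
  by_contra hp
  have h1 := (localMin_conditions_of_unit hH hzs hn
    (ξ := ‖projGrad H g zs‖⁻¹ • projGrad H g zs) (norm_smul_inv_norm (𝕜 := ℝ) hp) (by
      rw [real_inner_smul_left, inner_projGrad_self hn, mul_zero])).1
  rw [real_inner_smul_right, real_inner_self_eq_norm_sq] at h1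
  have := norm_pos_iff.2 hp
  have h2 : 0 < ‖projGrad H g zs‖⁻¹ * ‖projGrad H g zs‖ ^ 2 := by positivity
  linarith

/-- In the easy case, the second order condition at a local minimizer on the sphere is strict. -/
theorem inner_shifted_pos (hH : H.IsSymm) {l₁ : ℝ}
    (hle : ∀ x, l₁ * ‖x‖ ^ 2 ≤ ⟪H.toEuclideanLin x, x⟫)
    {v₁ : EuclideanSpace ℝ (Fin n)} (hv₁ : H.toEuclideanLin v₁ = l₁ • v₁) (hgv₁ : ⟪g, v₁⟫ ≠ 0)
    {zs : EuclideanSpace ℝ (Fin n)}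
    (hzs : IsLocalMinOn (objective H g) (Metric.sphere 0 1) zs) (hn : ‖zs‖ = 1)
    {ξ : EuclideanSpace ℝ (Fin n)} (hξ0 : ξ ≠ 0) (ho : ⟪ξ, zs⟫ = 0) :
    0 < ⟪ξ, shifted H g zs ξ⟫ := by
  have hp := projGrad_eq_zero_of_isLocalMinOn hH hzs hn
  set A := shifted H g zs with hA
  have hAs : A.IsSymmetric := isSymmetric_shifted hH zs
  have hnonneg : ∀ y, ⟪y, zs⟫ = 0 → 0 ≤ ⟪y, A y⟫ := by
    intro y hy
    by_cases hy0 : y = 0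
    · simp [hy0]
    have h1 := (localMin_conditions_of_unit hH hzs hn (ξ := ‖y‖⁻¹ • y)
      (norm_smul_inv_norm (𝕜 := ℝ) hy0) (by rw [real_inner_smul_left, hy, mul_zero])).2.1
    rw [map_smul, real_inner_smul_left, real_inner_smul_right, ← mul_assoc] at h1
    have := norm_pos_iff.2 hy0
    exact nonneg_of_mul_nonneg_right h1 (by positivity)
  by_contra hcon
  have hq0 : ⟪ξ, A ξ⟫ = 0 := le_antisymm (not_lt.1 hcon) (hnonneg ξ ho)
  set η := ‖ξ‖⁻¹ • ξ with hη
  have hη1 : ‖η‖ = 1 := norm_smul_inv_norm (𝕜 := ℝ) hξ0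
  have hηo : ⟪η, zs⟫ = 0 := by rw [hη, real_inner_smul_left, ho, mul_zero]
  have hηq : ⟪η, A η⟫ = 0 := by
    rw [hη, map_smul, real_inner_smul_left, real_inner_smul_right, hq0, mul_zero, mul_zero]
  have hzη : ⟪zs, A η⟫ = 0 := (localMin_conditions_of_unit hH hzs hn hη1 hηo).2.2 hηq
  -- A null vector of a positive semidefinite form lies in its radical: the form at `y + t • η` is
  -- affine in `t` and bounded below, so its slope is zero.
  have hker : ∀ y, ⟪y, zs⟫ = 0 → ⟪y, A η⟫ = 0 := by
    intro y hy
    have h1 : ∀ t : ℝ, 0 ≤ ⟪y, A y⟫ + 2 * t * ⟪y, A η⟫ := by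
      intro t
      have h2 := hnonneg (y + t • η) (by
        rw [inner_add_left, real_inner_smul_left, hy, hηo, mul_zero, add_zero])
      have h3 := hAs y η
      rw [real_inner_comm] at h3
      simp only [map_add, map_smul, inner_add_left, inner_add_right, real_inner_smul_left,
        real_inner_smul_right, hηq, h3] at h2
      linarith
    by_contra hne
    have h2 := h1 (-(⟪y, A y⟫ + 1) / (2 * ⟪y, A η⟫))
    have h3 : ⟪y, A y⟫ + 2 * (-(⟪y, A y⟫ + 1) / (2 * ⟪y, A η⟫)) * ⟪y, A η⟫ = -1 := by
      field_simp
      ring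
    linarith
  -- By the third order condition `A η` is itself tangent, so `hker` can be tested on `y = A η`.
  have hAη : A η = 0 := by
    rw [real_inner_comm] at hzη
    exact inner_self_eq_zero.1 (hker _ hzη)
  set k := l₁ - ⟪zs, H.toEuclideanLin zs + g⟫ with hk
  have hAv : A v₁ = k • v₁ := by rw [hA, shifted_apply, hv₁, hk, sub_smul]
  have hgk : ⟪g, v₁⟫ = -(k * ⟪zs, v₁⟫) := by
    have h1 := hAs zs v₁
    rw [hA, shifted_self hp, ← hA, hAv, inner_neg_left, real_inner_smul_right] at h1
    linarith
  have hk0 : k ≠ 0 := fun h => hgv₁ (by rw [hgk, h]; ring)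
  have hzv : ⟪zs, v₁⟫ ≠ 0 := fun h => hgv₁ (by rw [hgk, h]; ring)
  rcases hk0.lt_or_gt with hneg | hpos
  · have hvη : ⟪v₁, η⟫ = 0 := by
      have h1 := hAs v₁ η
      rw [hAη, hAv, inner_zero_right, real_inner_smul_left] at h1
      exact (mul_eq_zero.1 h1).resolve_left hk0
    set u := (-⟪zs, v₁⟫⁻¹) • v₁ with hu
    have hzu : ⟪zs, u⟫ = -1 := by
      rw [hu, real_inner_smul_right]; field_simp
    have huη : ⟪η, u⟫ = 0 := by
      rw [hu, real_inner_smul_right, real_inner_comm v₁ η, hvη, mul_zero]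
    have hAu : A u = k • u := by rw [hu, map_smul, hAv, smul_comm]
    have hu0 : u ≠ 0 := fun h => by rw [h, inner_zero_right] at hzu; norm_num at hzu
    -- Since `⟪zs, u⟫ = -1`, the vector `u` points into the ball; the square root is the amount of
    -- `η` that returns to the sphere. As `A η = 0`, the objective changes by exactly ½kτ²‖u‖² < 0.
    set w : ℝ → EuclideanSpace ℝ (Fin n) :=
      fun τ => zs + (Real.sqrt (2 * τ - τ ^ 2 * ‖u‖ ^ 2) • η + τ • u) with hw
    have hcont : Continuous w := by fun_prop
    have h0 : w 0 = zs := by simp [hw]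
    have hsmall : ∀ᶠ τ in 𝓝[>] (0 : ℝ), 0 < τ ∧ 0 < 2 - τ * ‖u‖ ^ 2 := by
      refine (eventually_mem_nhdsWithin).and (Filter.Eventually.filter_mono nhdsWithin_le_nhds ?_)
      have : Continuous fun τ : ℝ => 2 - τ * ‖u‖ ^ 2 := by fun_prop
      exact continuousAt_const.eventually_lt this.continuousAt (by norm_num)
    have hnorm : ∀ᶠ τ in 𝓝[>] (0 : ℝ), ‖w τ‖ = 1 := by
      filter_upwards [hsmall] with τ hτ
      have h1 : 0 ≤ 2 * τ - τ ^ 2 * ‖u‖ ^ 2 := by nlinarith [mul_pos hτ.1 hτ.2]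
      have h3 : ‖w τ‖ ^ 2 = 1 := by
        simp only [hw]
        rw [norm_add_sq_real, norm_add_sq_real, inner_add_right]
        simp only [real_inner_smul_left, real_inner_smul_right, hzu, huη, norm_smul, hη1, hn,
          Real.norm_eq_abs, mul_pow, sq_abs, Real.sq_sqrt h1, real_inner_comm η zs, hηo]
        ring
      exact (pow_eq_one_iff_of_nonneg (norm_nonneg _) two_ne_zero).1 h3
    have ht : Tendsto w (𝓝[>] 0) (𝓝[Metric.sphere 0 1] zs) := by
      refine tendsto_nhdsWithin_iff.2
        ⟨(h0 ▸ hcont.tendsto 0).mono_left nhdsWithin_le_nhds, hnorm.mono fun x hx => ?_⟩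
      simpa using hx
    obtain ⟨τ, ⟨h1, h2⟩, h3⟩ := ((hsmall.and hnorm).and (ht.eventually hzs)).exists
    have h4 := objective_sub_of_norm_eq_one (g := g) hH hn h2
    have h5 : w τ - zs = Real.sqrt (2 * τ - τ ^ 2 * ‖u‖ ^ 2) • η + τ • u := by simp [hw]
    rw [h5, hp, ← hA, map_add, map_smul A _ η, map_smul A τ u, hAη, hAu] at h4
    simp only [inner_zero_left, smul_zero, zero_add, inner_add_left, real_inner_smul_left,
      real_inner_smul_right, huη, real_inner_self_eq_norm_sq] at h4
    have h6 : 0 < ‖u‖ ^ 2 := pow_pos (norm_pos_iff.2 hu0) 2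
    have h7 : 0 < τ ^ 2 * ‖u‖ ^ 2 := mul_pos (pow_pos h1.1 2) h6
    have h8 : objective H g zs ≤ objective H g (w τ) := h3
    nlinarith [mul_pos_of_neg_of_neg hneg (neg_lt_zero.2 h7)]
  -- Here the Rayleigh quotient of `H` at `η` is the multiplier `l₁ - k`, below the smallest
  -- eigenvalue.
  · have h1 := hle η
    rw [hA, shifted_apply, inner_sub_right, real_inner_smul_right, inner_self_eq_one hη1,
      real_inner_comm] at hηq
    rw [hη1] at h1
    linarith

/-- The multiplier of a global minimizer on the ball in the easy case. -/
theorem multiplier_of_isMinOn_closedBall (hH : H.IsSymm) {l₁ : ℝ}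
    {v₁ : EuclideanSpace ℝ (Fin n)} (hv₁ : H.toEuclideanLin v₁ = l₁ • v₁) (hgv₁ : ⟪g, v₁⟫ ≠ 0)
    {zs : EuclideanSpace ℝ (Fin n)} (hn : ‖zs‖ = 1)
    (hp : projGrad H g zs = 0) (hmin : IsMinOn (objective H g) (Metric.closedBall 0 1) zs) :
    0 ≤ -⟪zs, H.toEuclideanLin zs + g⟫ ∧ 0 < -⟪zs, H.toEuclideanLin zs + g⟫ + l₁ := by
  set m := ⟪zs, H.toEuclideanLin zs + g⟫ with hm
  constructor
  -- Sign of the multiplier: compare `zs` with the interior points (1 - τ) zs.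
  · have h : ∀ᶠ τ in 𝓝[>] (0 : ℝ),
        m ≤ τ * (1 / 2 * ⟪zs, H.toEuclideanLin zs⟫) := by
      have h1 : ∀ᶠ τ in 𝓝[>] (0 : ℝ), τ < 1 :=
        (eventually_lt_nhds one_pos).filter_mono nhdsWithin_le_nhds
      filter_upwards [h1, self_mem_nhdsWithin] with τ hτ1 hτ0
      have hτ0 : 0 < τ := hτ0
      have hmem : zs + (-τ) • zs ∈ Metric.closedBall (0 : EuclideanSpace ℝ (Fin n)) 1 := by
        have h2 : zs + (-τ) • zs = (1 - τ) • zs := by rw [sub_smul, one_smul, neg_smul]; abel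
        rw [mem_closedBall_zero_iff, h2, norm_smul, hn, Real.norm_eq_abs, mul_one,
          abs_of_pos (by linarith)]
        linarith
      have h2 : objective H g zs ≤ objective H g (zs + (-τ) • zs) := hmin hmem
      rw [objective_add hH, map_smul] at h2
      simp only [real_inner_smul_left, real_inner_smul_right] at h2
      rw [real_inner_comm, ← hm] at h2
      have h3 : τ * m ≤ τ * (τ * (1 / 2 * ⟪zs, H.toEuclideanLin zs⟫)) := by linarith
      exact le_of_mul_le_mul_left h3 hτ0
    have hc : Tendsto (fun τ : ℝ => τ * (1 / 2 * ⟪zs, H.toEuclideanLin zs⟫)) (𝓝[>] 0) (𝓝 0) := by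
      have : Continuous fun τ : ℝ => τ * (1 / 2 * ⟪zs, H.toEuclideanLin zs⟫) := by fun_prop
      simpa using (this.tendsto 0).mono_left nhdsWithin_le_nhds
    have := ge_of_tendsto hc h
    linarith
  · have hAv : shifted H g zs v₁ = (l₁ - m) • v₁ := by rw [shifted_apply, hv₁, sub_smul]
    have hgk : ⟪g, v₁⟫ = -((l₁ - m) * ⟪zs, v₁⟫) := by
      have h1 := isSymmetric_shifted (g := g) hH zs zs v₁
      rw [shifted_self hp, hAv, inner_neg_left, real_inner_smul_right] at h1
      linarith
    have hk0 : l₁ - m ≠ 0 := fun h => hgv₁ (by rw [hgk, h]; ring)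
    have hzv : ⟪zs, v₁⟫ ≠ 0 := fun h => hgv₁ (by rw [hgk, h]; ring)
    have hv0 : v₁ ≠ 0 := fun h => hzv (by rw [h, inner_zero_right])
    have hv2 : 0 < ‖v₁‖ ^ 2 := pow_pos (norm_pos_iff.2 hv0) 2
    -- With this `s`, `zs + s • v₁` is the reflection of `zs` in the hyperplane orthogonal to `v₁`.
    -- It stays on the sphere, and the objective changes by exactly ½(l₁ - m)s²‖v₁‖².
    set s := -(2 * ⟪zs, v₁⟫ / ‖v₁‖ ^ 2) with hs
    have hs0 : s ≠ 0 := by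
      rw [hs]; exact neg_ne_zero.2 (div_ne_zero (mul_ne_zero two_ne_zero hzv) hv2.ne')
    have hnorm : ‖zs + s • v₁‖ = 1 := by
      have h3 : ‖zs + s • v₁‖ ^ 2 = 1 := by
        rw [norm_add_sq_real, real_inner_smul_right, norm_smul, mul_pow, Real.norm_eq_abs, sq_abs,
          hn, hs]
        field_simp
        ring
      exact (pow_eq_one_iff_of_nonneg (norm_nonneg _) two_ne_zero).1 h3
    have h1 : objective H g zs ≤ objective H g (zs + s • v₁) :=
      hmin (by rw [mem_closedBall_zero_iff, hnorm])
    have h2 := objective_sub_of_norm_eq_one (g := g) hH hn hnorm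
    rw [hp, add_sub_cancel_left, map_smul, hAv] at h2
    simp only [inner_zero_left, real_inner_smul_left, real_inner_smul_right,
      real_inner_self_eq_norm_sq] at h2
    have h3 : 0 < s ^ 2 * ‖v₁‖ ^ 2 := mul_pos (sq_pos_of_ne_zero hs0) hv2
    have h4 : 0 ≤ l₁ - m := by
      by_contra! hneg
      nlinarith
    have := lt_of_le_of_ne h4 hk0.symm
    linarith

end Objective

end TrustRegion
namespace TrustRegion

/-! ### The Riemannian Hessian as the shifted matrix on the tangent space -/

section Hessian

variable {n : ℕ} {H : Matrix (Fin n) (Fin n) ℝ} {g : EuclideanSpace ℝ (Fin n)}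

theorem hasFDerivAt_toEuclideanLin (x : EuclideanSpace ℝ (Fin n)) :
    HasFDerivAt (fun z => H.toEuclideanLin z) H.toEuclideanLin.toContinuousLinearMap x :=
  H.toEuclideanLin.toContinuousLinearMap.hasFDerivAt

theorem gradient_objective (hH : H.IsSymm) (z : EuclideanSpace ℝ (Fin n)) :
    ∇ (objective H g) z = H.toEuclideanLin z + g := by
  apply HasGradientAt.gradient
  rw [hasGradientAt_iff_hasFDerivAt]
  have h := (((hasFDerivAt_id z).inner ℝ (hasFDerivAt_toEuclideanLin (H := H) z)).const_mul
    (1 / 2 : ℝ)).add ((hasFDerivAt_const g z).inner ℝ (hasFDerivAt_id z))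
  refine HasFDerivAt.congr_fderiv h ?_
  ext v
  have h1 := isSymmetric_toEuclideanLin hH z v
  simp [real_inner_comm (H.toEuclideanLin z) v, h1]
  ring

theorem sphereGrad_objective (hH : H.IsSymm) :
    sphereGrad (objective H g) = projGrad H g := by
  funext z
  rw [sphereGrad, gradient_objective hH, projGrad]

/-- Differentiating the normal part ⟪y, Hy + g⟫ y yields the multiplier times `ξ` plus a multiple of
`x`, and the latter is orthogonal to `η`. -/
theorem inner_sphereHess (hH : H.IsSymm) (x : EuclideanSpace ℝ (Fin n)) (ξ η : tangent x) :
    ⟪sphereHess (objective H g) x ξ, η⟫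
      = ⟪shifted H g x (ξ : EuclideanSpace ℝ (Fin n)), (η : EuclideanSpace ℝ (Fin n))⟫ := by
  have hxη : ⟪x, (η : EuclideanSpace ℝ (Fin n))⟫ = 0 :=
    (Submodule.mem_orthogonal_singleton_iff_inner_right).1 η.2
  have hG := (hasFDerivAt_toEuclideanLin (H := H) x).add_const g
  have h1 : HasFDerivAt (projGrad H g) _ x :=
    hG.sub (((hasFDerivAt_id x).inner ℝ hG).smul (hasFDerivAt_id x))
  have h2 : ⟪sphereHess (objective H g) x ξ, η⟫
      = ⟪fderiv ℝ (sphereGrad (objective H g)) x ξ, (η : EuclideanSpace ℝ (Fin n))⟫ := by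
    simp [sphereHess]
  rw [h2, sphereGrad_objective hH, h1.fderiv, shifted_apply]
  simp [inner_sub_left, inner_add_left, inner_smul_left, hxη]

end Hessian

/-! ### Gradient domination, descent, and the linear rate -/

section Rate

variable {n : ℕ} {H : Matrix (Fin n) (Fin n) ℝ} {g : EuclideanSpace ℝ (Fin n)}

theorem continuous_projGrad : Continuous (projGrad H g) := by
  have : Continuous fun z => H.toEuclideanLin z :=
    H.toEuclideanLin.continuous_of_finiteDimensional
  unfold projGrad
  fun_prop

/-- Criticality makes `H zs + g` a multiple of `zs`, so `shifted H g zs (z - zs)` differs from `H z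
+ g` by a multiple of `z`, which the projection at `z` removes. -/
theorem projGrad_eq_shifted {zs : EuclideanSpace ℝ (Fin n)} (hp : projGrad H g zs = 0)
    {z : EuclideanSpace ℝ (Fin n)} (hz : ‖z‖ = 1) :
    projGrad H g z = shifted H g zs (z - zs) - ⟪z, shifted H g zs (z - zs)⟫ • z := by
  rw [projGrad, sub_eq_zero] at hp
  set m := ⟪zs, H.toEuclideanLin zs + g⟫ with hm
  have h1 : shifted H g zs (z - zs) = H.toEuclideanLin z + g - m • z := by
    rw [shifted_apply, map_sub, smul_sub, ← hm, ← hp]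
    abel
  rw [h1, inner_sub_right, real_inner_smul_right, inner_self_eq_one hz, projGrad, sub_smul]
  simp only [mul_one]
  abel

/-- Near a point satisfying the second order sufficient condition, the squared norm of the
Riemannian gradient dominates the optimality gap. -/
theorem eventually_gap_le_sq_norm_projGrad (hH : H.IsSymm) {zs : EuclideanSpace ℝ (Fin n)}
    (hn : ‖zs‖ = 1) (hp : projGrad H g zs = 0) {lmin μ : ℝ} (hμ : 0 < μ) (hμl : μ < lmin)
    (hmin : ∀ x, ⟪x, zs⟫ = 0 → lmin * ‖x‖ ^ 2 ≤ ⟪x, shifted H g zs x⟫) :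
    ∀ᶠ z in 𝓝 zs, ‖z‖ = 1 → 0 ≤ objective H g z - objective H g zs ∧
      2 * μ * (objective H g z - objective H g zs) ≤ ‖projGrad H g z‖ ^ 2 := by
  obtain ⟨μ', h1, h2⟩ := exists_between hμl
  have hμ' : 0 < μ' := hμ.trans h1
  obtain ⟨δ, hδ, hcone⟩ := exists_cone_le_inner (shifted H g zs) hn h2 hmin
  set M := ‖(shifted H g zs).toContinuousLinearMap‖ with hM
  have hA : ∀ x, ‖shifted H g zs x‖ ≤ M * ‖x‖ :=
    (shifted H g zs).toContinuousLinearMap.le_opNorm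
  have hM0 : 0 ≤ M := norm_nonneg _
  have e1 : ∀ᶠ z in 𝓝 zs, ‖z - zs‖ < δ := by
    have : Continuous fun z => ‖z - zs‖ := by fun_prop
    exact this.continuousAt.eventually_lt continuousAt_const (by simpa using hδ)
  have e2 : ∀ᶠ z in 𝓝 zs, 0 < 1 - M / (2 * μ') * ‖z - zs‖ := by
    have : Continuous fun z => 1 - M / (2 * μ') * ‖z - zs‖ := by fun_prop
    exact continuousAt_const.eventually_lt this.continuousAt (by simp)
  have e3 : ∀ᶠ z in 𝓝 zs, μ < μ' * (1 - M / (2 * μ') * ‖z - zs‖) ^ 2 := by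
    have : Continuous fun z => μ' * (1 - M / (2 * μ') * ‖z - zs‖) ^ 2 := by fun_prop
    exact continuousAt_const.eventually_lt this.continuousAt (by simpa using h1)
  filter_upwards [e1, e2, e3] with z hz1 hz2 hz3 hz
  have hF := objective_sub_of_norm_eq_one (g := g) hH hn hz
  rw [hp, inner_zero_left, zero_add] at hF
  have hd := inner_self_sub_of_norm_eq_one hn hz
  have hd' : ⟪z, z - zs⟫ = 1 / 2 * ‖z - zs‖ ^ 2 := by
    have h3 : ⟪z, z - zs⟫ = ⟪zs, z - zs⟫ + ⟪z - zs, z - zs⟫ := by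
      rw [← inner_add_left, add_sub_cancel]
    rw [h3, hd, real_inner_self_eq_norm_sq]
    ring
  have hpd : ⟪projGrad H g z, z - zs⟫ = ⟪z - zs, shifted H g zs (z - zs)⟫
      - ⟪z, shifted H g zs (z - zs)⟫ * (1 / 2 * ‖z - zs‖ ^ 2) := by
    rw [projGrad_eq_shifted hp hz, inner_sub_left, real_inner_smul_left, hd', real_inner_comm]
  -- A chord of the sphere is tangent up to second order, so short chords lie in the cone.
  have hQ := hcone (z - zs) (by
    rw [real_inner_comm, hd, abs_mul, abs_neg, abs_of_pos (by norm_num : (0 : ℝ) < 1 / 2), abs_sq]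
    nlinarith [norm_nonneg (z - zs)])
  have hzA : |⟪z, shifted H g zs (z - zs)⟫| ≤ M * ‖z - zs‖ := by
    refine (abs_real_inner_le_norm _ _).trans ?_
    rw [hz, one_mul]
    exact hA _
  have hpd' := (abs_le.1 (abs_real_inner_le_norm (projGrad H g z) (z - zs))).2
  set e := ‖z - zs‖ with he
  set P := ‖projGrad H g z‖ with hP
  set Q := ⟪z - zs, shifted H g zs (z - zs)⟫ with hQdef
  have he0 : 0 ≤ e := norm_nonneg _
  have hP0 : 0 ≤ P := norm_nonneg _
  have hQ0 : 0 ≤ Q := le_trans (by positivity) hQ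
  rw [hF]
  refine ⟨by linarith, ?_⟩
  rcases hQ0.eq_or_lt with h0 | hQpos
  · rw [← h0]; nlinarith
  -- `θ` is the relative size of the curvature correction in ⟪p, z - zs⟫ compared with `Q`.
  -- Cauchy–Schwarz gives (1 - θ)Q ≤ Pe; squaring and using e² ≤ Q/μ' leaves μ'(1 - θ)²Q ≤ P², where
  -- `Q` is twice the gap.
  set θ := M / (2 * μ') * e with hθ
  have h3 : (1 - θ) * Q ≤ P * e := by
    have h4 : M * e * (1 / 2 * e ^ 2) ≤ θ * Q := by
      have h5 : M * e * (1 / 2 * e ^ 2) = θ * (μ' * e ^ 2) := by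
        rw [hθ]; field_simp
      rw [h5]
      exact mul_le_mul_of_nonneg_left hQ (by positivity)
    have h6 : ⟪z, shifted H g zs (z - zs)⟫ * (1 / 2 * e ^ 2) ≤ M * e * (1 / 2 * e ^ 2) :=
      mul_le_mul_of_nonneg_right ((le_abs_self _).trans hzA) (by positivity)
    linarith
  have h4 : ((1 - θ) * Q) ^ 2 ≤ (P * e) ^ 2 := pow_le_pow_left₀ (by positivity) h3 2
  have h5 : μ' * (1 - θ) ^ 2 * Q * Q ≤ P ^ 2 * Q := by
    have h6 : μ' * ((1 - θ) * Q) ^ 2 ≤ μ' * (P * e) ^ 2 := mul_le_mul_of_nonneg_left h4 hμ'.le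
    have h7 : P ^ 2 * (μ' * e ^ 2) ≤ P ^ 2 * Q := mul_le_mul_of_nonneg_left hQ (sq_nonneg P)
    linarith
  have h6 := le_of_mul_le_mul_right h5 hQpos
  have h7 := mul_le_mul_of_nonneg_right hz3.le hQ0
  linarith

/-- The difference of the two sides is (ν - 1)²(ν + 2) / (2ν). It controls the effect of normalizing
the trial point. -/
theorem one_sub_half_le_inv {ν X : ℝ} (hν : 0 < ν) (h : ν ^ 2 = 1 + X) (hX : 0 ≤ X) :
    1 - X / 2 ≤ ν⁻¹ := by
  have h1 : 1 ≤ ν := by nlinarith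
  have h2 : ν * ν⁻¹ = 1 := mul_inv_cancel₀ hν.ne'
  have h3 : 0 < ν⁻¹ := inv_pos.2 hν
  nlinarith [mul_nonneg h3.le (sq_nonneg (ν - 1)), sq_nonneg (ν - 1)]

/-- Descent inequality for the projected gradient step near a critical point. -/
theorem eventually_descent (hH : H.IsSymm) {zs : EuclideanSpace ℝ (Fin n)}
    (hn : ‖zs‖ = 1) (hp : projGrad H g zs = 0) {lmax Λ αbar : ℝ} (hl : 0 < lmax) (hΛ : lmax < Λ)
    (hmax : ∀ x, ⟪x, zs⟫ = 0 → ⟪x, shifted H g zs x⟫ ≤ lmax * ‖x‖ ^ 2) :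
    ∀ᶠ z in 𝓝 zs, ‖z‖ = 1 → ∀ α, 0 ≤ α → α ≤ αbar →
      objective H g (trialPoint H g z α) - objective H g z
        ≤ -(α * ‖projGrad H g z‖ ^ 2) + 1 / 2 * Λ * α ^ 2 * ‖projGrad H g z‖ ^ 2 := by
  obtain ⟨Λ', h1, h2⟩ := exists_between hΛ
  have hΛ' : 0 < Λ' := hl.trans h1
  obtain ⟨δ, hδ, hcone⟩ := exists_cone_inner_le (shifted H g zs) hn h1 hmax
  have hpc : Continuous (projGrad H g) := continuous_projGrad
  have hTc : Continuous fun z => H.toEuclideanLin z :=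
    H.toEuclideanLin.continuous_of_finiteDimensional
  set m : EuclideanSpace ℝ (Fin n) → ℝ := fun z => ⟪z, H.toEuclideanLin z + g⟫ with hm
  have hmc : Continuous m := by fun_prop
  have e1 : ∀ᶠ z in 𝓝 zs, 1 / 2 * (αbar * ‖projGrad H g z‖) + ‖z - zs‖ < δ := by
    have : Continuous fun z => 1 / 2 * (αbar * ‖projGrad H g z‖) + ‖z - zs‖ := by fun_prop
    exact this.continuousAt.eventually_lt continuousAt_const (by simpa [hp] using hδ)
  -- The slack `Λ - Λ'` pays for moving the multiplier from `z` to `zs` and for the normalization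
  -- error in the linear term.
  have e2 : ∀ᶠ z in 𝓝 zs, |m zs - m z| + αbar * ‖projGrad H g z‖ ^ 2 < Λ - Λ' := by
    have : Continuous fun z => |m zs - m z| + αbar * ‖projGrad H g z‖ ^ 2 := by fun_prop
    exact this.continuousAt.eventually_lt continuousAt_const (by simpa [hp] using h2)
  filter_upwards [e1, e2] with z hz1 hz2 hz α hα0 hα
  set p := projGrad H g z with hpdef
  have hpz : ⟪p, z⟫ = 0 := inner_projGrad_self hz
  have hν2 : ‖z - α • p‖ ^ 2 = 1 + α ^ 2 * ‖p‖ ^ 2 := by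
    rw [norm_sub_sq_real, real_inner_smul_right, real_inner_comm, hpz, norm_smul, hz, mul_pow,
      Real.norm_eq_abs, sq_abs]
    ring
  have hν : 0 < ‖z - α • p‖ := by
    refine lt_of_le_of_ne (norm_nonneg _) fun h => ?_
    rw [← h] at hν2
    have : 0 ≤ α ^ 2 * ‖p‖ ^ 2 := by positivity
    norm_num at hν2
    linarith
  have hR : trialPoint H g z α = ‖z - α • p‖⁻¹ • (z - α • p) := rfl
  set R := trialPoint H g z α with hRdef
  have hs := one_sub_half_le_inv hν hν2 (by positivity)
  set s := ‖z - α • p‖⁻¹ with hsdef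
  have hR1 : ‖R‖ = 1 := by
    rw [hR, norm_smul, hsdef, norm_inv, norm_norm, inv_mul_cancel₀ hν.ne']
  have hRz : ⟪z, R⟫ = s := by
    rw [hR, real_inner_smul_right, inner_sub_right, real_inner_smul_right, inner_self_eq_one hz,
      real_inner_comm, hpz]
    ring
  have hpD : ⟪p, R - z⟫ = -(α * ‖p‖ ^ 2 * s) := by
    rw [inner_sub_right, hpz, hR, real_inner_smul_right, inner_sub_right, real_inner_smul_right,
      hpz, real_inner_self_eq_norm_sq]
    ring
  have hzD := inner_self_sub_of_norm_eq_one hz hR1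
  have hD2 : ‖R - z‖ ^ 2 ≤ α ^ 2 * ‖p‖ ^ 2 := by
    have : ⟪z, R - z⟫ = s - 1 := by rw [inner_sub_right, hRz, inner_self_eq_one hz]
    linarith
  have hD : ‖R - z‖ ≤ αbar * ‖p‖ := by
    have : ‖R - z‖ ≤ α * ‖p‖ := by
      refine (sq_le_sq₀ (norm_nonneg _) (by positivity)).1 ?_
      rwa [mul_pow]
    exact this.trans (mul_le_mul_of_nonneg_right hα (norm_nonneg _))
  have hc := hcone (R - z) (by
    have h3 : ⟪R - z, zs⟫ = ⟪z, R - z⟫ - ⟪R - z, z - zs⟫ := by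
      rw [inner_sub_right (R - z) z zs, real_inner_comm z (R - z)]
      ring
    have h4 : |⟪R - z, z - zs⟫| ≤ ‖R - z‖ * ‖z - zs‖ := abs_real_inner_le_norm _ _
    rw [h3, hzD]
    have h5 := abs_sub (-(1 / 2) * ‖R - z‖ ^ 2) ⟪R - z, z - zs⟫
    rw [abs_mul, abs_neg, abs_of_pos (by norm_num : (0 : ℝ) < 1 / 2), abs_sq] at h5
    have h6 : (1 / 2 * (αbar * ‖p‖) + ‖z - zs‖) * ‖R - z‖ ≤ δ * ‖R - z‖ :=
      mul_le_mul_of_nonneg_right hz1.le (norm_nonneg _)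
    have h7 := mul_le_mul_of_nonneg_right hD (norm_nonneg (R - z))
    linarith)
  have hF := objective_sub_of_norm_eq_one (g := g) hH hz hR1
  have hsh : ⟪R - z, shifted H g z (R - z)⟫
      = ⟪R - z, shifted H g zs (R - z)⟫ + (m zs - m z) * ‖R - z‖ ^ 2 := by
    simp only [shifted_apply]
    generalize R - z = D
    rw [inner_sub_right, inner_sub_right, real_inner_smul_right, real_inner_smul_right,
      real_inner_self_eq_norm_sq]
    ring
  rw [hF, ← hpdef, hpD, hsh]
  set Δ := |m zs - m z| with hΔ
  have hΔ0 : 0 ≤ Δ := abs_nonneg _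
  have h3 : (m zs - m z) * ‖R - z‖ ^ 2 ≤ Δ * ‖R - z‖ ^ 2 :=
    mul_le_mul_of_nonneg_right (le_abs_self _) (sq_nonneg _)
  have h4 : (Λ' + Δ) * ‖R - z‖ ^ 2 ≤ (Λ' + Δ) * (α ^ 2 * ‖p‖ ^ 2) :=
    mul_le_mul_of_nonneg_left hD2 (by positivity)
  have h5 : α * ‖p‖ ^ 2 * (1 - α ^ 2 * ‖p‖ ^ 2 / 2) ≤ α * ‖p‖ ^ 2 * s :=
    mul_le_mul_of_nonneg_left hs (by positivity)
  have h6 : α * ‖p‖ ^ 2 ≤ αbar * ‖p‖ ^ 2 := mul_le_mul_of_nonneg_right hα (sq_nonneg _)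
  have h7 : (Λ' + Δ + α * ‖p‖ ^ 2) * (α ^ 2 * ‖p‖ ^ 2) ≤ Λ * (α ^ 2 * ‖p‖ ^ 2) :=
    mul_le_mul_of_nonneg_right (by linarith) (by positivity)
  linarith

/-- Armijo backtracking does not return a much smaller step than the descent inequality allows. -/
theorem IsArmijoStep.min_le {αbar β σ α Λ : ℝ} {z : EuclideanSpace ℝ (Fin n)}
    (h : IsArmijoStep H g αbar β σ z α) (hαbar : 0 < αbar) (hβ : β ∈ Set.Ioo (0 : ℝ) 1)
    (hΛ : 0 < Λ)
    (hdesc : ∀ α, 0 ≤ α → α ≤ αbar →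
      objective H g (trialPoint H g z α) - objective H g z
        ≤ -(α * ‖projGrad H g z‖ ^ 2) + 1 / 2 * Λ * α ^ 2 * ‖projGrad H g z‖ ^ 2) :
    min αbar (2 * (1 - σ) * β / Λ) ≤ α := by
  obtain ⟨m, rfl, hm⟩ := h
  rcases m with _ | m
  · simp
  refine (min_le_right _ _).trans ?_
  -- The preceding trial `a`, with accepted step `β * a`, was rejected; against the descent
  -- inequality this forces ½Λa > 1 - σ.
  have hnot : ¬ SufficientDecrease H g σ z (β ^ m * αbar) := fun hs => by
    have := hm.2 hs
    omega
  rw [SufficientDecrease, not_le] at hnot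
  set a := β ^ m * αbar with ha
  have ha0 : 0 < a := mul_pos (pow_pos hβ.1 m) hαbar
  have ha1 : a ≤ αbar := mul_le_of_le_one_left hαbar.le (pow_le_one₀ hβ.1.le hβ.2.le)
  have hd := hdesc a ha0.le ha1
  set q := ‖projGrad H g z‖ ^ 2 with hq
  have hq0 : 0 ≤ q := sq_nonneg _
  have h1 : 0 < a * q * (1 / 2 * Λ * a - (1 - σ)) := by linarith
  have h2 : 0 < 1 / 2 * Λ * a - (1 - σ) := by
    by_contra! hneg
    have := mul_nonpos_of_nonneg_of_nonpos (mul_nonneg ha0.le hq0) hneg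
    linarith
  rw [div_le_iff₀ hΛ, pow_succ]
  have h3 := mul_pos h2 hβ.1
  have h4 : β ^ m * β * αbar = a * β := by rw [ha]; ring
  rw [h4]
  linarith

/-- All the inequalities are strict at ε = 0 and continuous there, so they survive for small ε > 0.
-/
theorem exists_pos_rate_le {αbar β σ lmin lmax r : ℝ} (hmin : 0 < lmin) (hmax : 0 < lmax)
    (hr : 1 - min (2 * σ * αbar * lmin) (4 * σ * (1 - σ) * β * (lmin / lmax)) < r) :
    ∃ ε > 0, 0 < lmin - ε ∧
      1 - r ≤ 2 * σ * (lmin - ε) * αbar ∧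
      1 - r ≤ 2 * σ * (lmin - ε) * (2 * (1 - σ) * β / (lmax + ε)) := by
  have h1 : 1 - r < 2 * σ * αbar * lmin :=
    (sub_lt_comm.1 hr).trans_le (min_le_left _ _)
  have h2 : 1 - r < 4 * σ * (1 - σ) * β * (lmin / lmax) :=
    (sub_lt_comm.1 hr).trans_le (min_le_right _ _)
  have e1 : ∀ᶠ ε in 𝓝 (0 : ℝ), 0 < lmin - ε := by
    have : Continuous fun ε : ℝ => lmin - ε := by fun_prop
    exact continuousAt_const.eventually_lt this.continuousAt (by simpa using hmin)
  have e2 : ∀ᶠ ε in 𝓝 (0 : ℝ), 1 - r < 2 * σ * (lmin - ε) * αbar := by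
    have : Continuous fun ε : ℝ => 2 * σ * (lmin - ε) * αbar := by fun_prop
    refine continuousAt_const.eventually_lt this.continuousAt ?_
    rw [sub_zero]
    linarith
  have e3 : ∀ᶠ ε in 𝓝 (0 : ℝ),
      1 - r < 2 * σ * (lmin - ε) * (2 * (1 - σ) * β / (lmax + ε)) := by
    have : ContinuousAt (fun ε : ℝ => 2 * σ * (lmin - ε) * (2 * (1 - σ) * β / (lmax + ε))) 0 := by
      refine ContinuousAt.mul (by fun_prop) (ContinuousAt.div (by fun_prop) (by fun_prop) ?_)
      simpa using hmax.ne'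
    refine continuousAt_const.eventually_lt this ?_
    rw [sub_zero, add_zero]
    refine h2.trans_eq ?_
    field_simp
    ring
  have e : ∀ᶠ ε in 𝓝[>] (0 : ℝ), _ := ((e1.and (e2.and e3)).filter_mono
    nhdsWithin_le_nhds).and self_mem_nhdsWithin
  obtain ⟨ε, ⟨h3, h4, h5⟩, h6⟩ := e.exists
  exact ⟨ε, h6, h3, h4.le, h5.le⟩

/-- The asymptotic linear rate of the line search projected gradient method at a limit point
satisfying the second order sufficient condition. -/
theorem IsPhaseTwo.exists_linear_rate (hH : H.IsSymm) {αbar β σ : ℝ} (hαbar : 0 < αbar)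
    (hβ : β ∈ Set.Ioo (0 : ℝ) 1) (hσ : σ ∈ Set.Ioo (0 : ℝ) 1) {T : ℕ}
    {z : ℕ → EuclideanSpace ℝ (Fin n)} (hz : IsPhaseTwo H g αbar β σ T z)
    {zs : EuclideanSpace ℝ (Fin n)} (hlim : Tendsto z atTop (𝓝 zs))
    (hn : ‖zs‖ = 1) (hp : projGrad H g zs = 0) {lmin lmax : ℝ} (hl : 0 < lmin) (hl' : 0 < lmax)
    (hmin : ∀ x, ⟪x, zs⟫ = 0 → lmin * ‖x‖ ^ 2 ≤ ⟪x, shifted H g zs x⟫)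
    (hmax : ∀ x, ⟪x, zs⟫ = 0 → ⟪x, shifted H g zs x⟫ ≤ lmax * ‖x‖ ^ 2) {r : ℝ}
    (hr : 1 - min (2 * σ * αbar * lmin) (4 * σ * (1 - σ) * β * (lmin / lmax)) < r) :
    ∃ K : ℕ, ∀ t ≥ K, objective H g (z (t + 1)) - objective H g zs
      ≤ r * (objective H g (z t) - objective H g zs) := by
  obtain ⟨ε, hε, hμ, hr1, hr2⟩ := exists_pos_rate_le hl hl' hr
  have e1 := hlim.eventually
    (eventually_gap_le_sq_norm_projGrad hH hn hp hμ (sub_lt_self _ hε) hmin)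
  have e2 := hlim.eventually
    (eventually_descent (αbar := αbar) hH hn hp hl' (lt_add_of_pos_right _ hε) hmax)
  refine eventually_atTop.1 ?_
  filter_upwards [e1, e2, eventually_ge_atTop T] with t h1 h2 ht
  obtain ⟨hzt, α, hα, hnext⟩ := hz t ht
  obtain ⟨hF, hg⟩ := h1 hzt
  have hαmin := hα.min_le hαbar hβ (by linarith) (h2 hzt)
  have hdec : SufficientDecrease H g σ (z t) α := by
    obtain ⟨m, rfl, hm⟩ := hα
    exact hm.1
  rw [SufficientDecrease, ← hnext] at hdec
  have hσμ : 0 ≤ 2 * σ * (lmin - ε) := mul_nonneg (mul_nonneg two_pos.le hσ.1.le) hμ.le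
  have hrα : 1 - r ≤ 2 * σ * (lmin - ε) * α := by
    refine le_trans ?_ (mul_le_mul_of_nonneg_left hαmin hσμ)
    rw [mul_min_of_nonneg _ _ hσμ]
    exact le_min hr1 hr2
  have hα0 : 0 ≤ α := by
    obtain ⟨m, rfl, -⟩ := hα
    exact mul_nonneg (pow_nonneg hβ.1.le m) hαbar.le
  -- Chain: decrease ≥ σα‖p‖² ≥ 2σ(lmin - ε)α · gap ≥ (1 - r) · gap.
  have h3 := mul_le_mul_of_nonneg_left hg (mul_nonneg hσ.1.le hα0)
  have h4 := mul_le_mul_of_nonneg_right hrα hF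
  linarith

end Rate

end TrustRegion

/-! ### The main theorem -/

open TrustRegion in
theorem mainTheorem3 {n : ℕ} (hn : 2 ≤ n)
    (H : Matrix (Fin n) (Fin n) ℝ) (hH : H.IsSymm) (g : EuclideanSpace ℝ (Fin n))
    -- the smallest eigenvalue `l₁` of `H` is negative
    (l₁ : ℝ) (hl₁ : IsLeast (eigenvalueSet H.toEuclideanLin) l₁) (hl₁neg : l₁ < 0)
    -- the easy case
    (v₁ : EuclideanSpace ℝ (Fin n)) (hv₁ : H.toEuclideanLin v₁ = l₁ • v₁) (hgv₁ : ⟪g, v₁⟫ ≠ 0)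
    -- the line search parameters
    (αbar β σ : ℝ) (hαbar : 0 < αbar) (hβ : β ∈ Set.Ioo (0 : ℝ) 1) (hσ : σ ∈ Set.Ioo (0 : ℝ) 1)
    -- the iterates
    (T : ℕ) (z : ℕ → EuclideanSpace ℝ (Fin n)) (hz : IsPhaseTwo H g αbar β σ T z)
    (zs : EuclideanSpace ℝ (Fin n)) (hlim : Tendsto z atTop (𝓝 zs))
    (hzs : IsLocalMinOn (objective H g) (Metric.sphere 0 1) zs) :
    -- the Riemannian Hessian at the limit is positive definite
    (sphereHess (objective H g) zs : tangent zs →ₗ[ℝ] tangent zs).IsSymmetric ∧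
    (∀ ξ : tangent zs, ξ ≠ 0 → 0 < ⟪sphereHess (objective H g) zs ξ, ξ⟫) ∧
    ∃ lmin lmax : ℝ,
      IsLeast (eigenvalueSet (sphereHess (objective H g) zs : tangent zs →ₗ[ℝ] tangent zs)) lmin ∧
      IsGreatest
        (eigenvalueSet (sphereHess (objective H g) zs : tangent zs →ₗ[ℝ] tangent zs)) lmax ∧
      0 < lmin ∧
      -- at the global minimizer, with its multiplier `l`, it is bounded below by `l + l₁ > 0`
      (IsMinOn (objective H g) (Metric.closedBall 0 1) zs →
        ∃ l : ℝ, 0 ≤ l ∧ H.toEuclideanLin zs + l • zs + g = 0 ∧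
          0 < l + l₁ ∧ l + l₁ ≤ lmin) ∧
      -- the asymptotic linear rate
      ∀ r ∈ Set.Ioo
          (1 - min (2 * σ * αbar * lmin) (4 * σ * (1 - σ) * β * (lmin / lmax))) 1,
        ∃ K : ℕ, ∀ t ≥ K,
          objective H g (z (t + 1)) - objective H g zs
            ≤ r * (objective H g (z t) - objective H g zs) := by

  -- `IsLocalMinOn` does not include membership in the sphere; the norm is obtained from the
  -- iterates in the limit.
  have hn1 : ‖zs‖ = 1 :=
    tendsto_nhds_unique hlim.norm (tendsto_const_nhds.congr'
      ((eventually_ge_atTop T).mono fun t ht => ((hz t ht).1).symm))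
  have hp := projGrad_eq_zero_of_isLocalMinOn hH hzs hn1
  have hfin : Module.finrank ℝ (EuclideanSpace ℝ (Fin n)) = n := finrank_euclideanSpace_fin
  have hEn : Nontrivial (EuclideanSpace ℝ (Fin n)) :=
    Module.nontrivial_of_finrank_pos (R := ℝ) (by omega)
  -- `2 ≤ n` makes the tangent space nonzero, so that extreme eigenvalues exist.
  have hTn : Nontrivial (tangent zs) := by
    have : Fact (Module.finrank ℝ (EuclideanSpace ℝ (Fin n)) = (n - 1) + 1) := ⟨by omega⟩
    have h1 : Module.finrank ℝ (tangent zs) = n - 1 :=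
      Submodule.finrank_orthogonal_span_singleton (norm_ne_zero_iff.1 (by rw [hn1]; norm_num))
    exact Module.nontrivial_of_finrank_pos (R := ℝ) (by omega)
  have hle : ∀ x, l₁ * ‖x‖ ^ 2 ≤ ⟪H.toEuclideanLin x, x⟫ := by
    obtain ⟨m, hm, hle⟩ := exists_isLeast_eigenvalueSet (isSymmetric_toEuclideanLin hH)
    rwa [hm.unique hl₁] at hle
  have hsymm : (sphereHess (objective H g) zs : tangent zs →ₗ[ℝ] tangent zs).IsSymmetric := by
    intro ξ η
    have h1 := inner_sphereHess (g := g) hH zs ξ η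
    have h2 := inner_sphereHess (g := g) hH zs η ξ
    have h3 := isSymmetric_shifted (g := g) hH zs (ξ : EuclideanSpace ℝ (Fin n)) η
    rw [real_inner_comm] at h2
    rw [real_inner_comm (ξ : EuclideanSpace ℝ (Fin n))] at h2
    exact h1.trans (h3.trans h2.symm)
  have hform : ∀ ξ : tangent zs, ⟪sphereHess (objective H g) zs ξ, ξ⟫
      = ⟪(ξ : EuclideanSpace ℝ (Fin n)), shifted H g zs ξ⟫ := fun ξ => by
    rw [inner_sphereHess hH, real_inner_comm]
  have horth : ∀ ξ : tangent zs, ⟪(ξ : EuclideanSpace ℝ (Fin n)), zs⟫ = 0 := fun ξ =>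
    (Submodule.mem_orthogonal_singleton_iff_inner_left).1 ξ.2
  have hpos : ∀ ξ : tangent zs, ξ ≠ 0 → 0 < ⟪sphereHess (objective H g) zs ξ, ξ⟫ := by
    intro ξ hξ
    rw [hform]
    exact inner_shifted_pos hH hle hv₁ hgv₁ hzs hn1 (fun h => hξ (Subtype.ext h)) (horth ξ)
  obtain ⟨lmin, hlmin, hlmin'⟩ := exists_isLeast_eigenvalueSet hsymm
  obtain ⟨lmax, hlmax, hlmax'⟩ := exists_isGreatest_eigenvalueSet hsymm
  obtain ⟨ξ, hξ⟩ := Module.End.HasEigenvalue.exists_hasEigenvector hlmin.1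
  have hξ2 : 0 < ‖ξ‖ ^ 2 := pow_pos (norm_pos_iff.2 hξ.2) 2
  have hval : ⟪sphereHess (objective H g) zs ξ, ξ⟫ = lmin * ‖ξ‖ ^ 2 := by
    have h1 : sphereHess (objective H g) zs ξ = lmin • ξ := hξ.apply_eq_smul
    rw [h1, real_inner_smul_left, real_inner_self_eq_norm_sq]
  have hlpos : 0 < lmin := by
    have h1 := hpos ξ hξ.2
    rw [hval] at h1
    exact pos_of_mul_pos_left h1 hξ2.le
  have hmem : ∀ x, ⟪x, zs⟫ = 0 → x ∈ tangent zs := fun x hx =>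
    (Submodule.mem_orthogonal_singleton_iff_inner_left).2 hx
  refine ⟨hsymm, hpos, lmin, lmax, hlmin, hlmax, hlpos, fun hglob => ?_, fun r hr => ?_⟩
  · obtain ⟨h1, h2⟩ := multiplier_of_isMinOn_closedBall hH hv₁ hgv₁ hn1 hp hglob
    refine ⟨_, h1, ?_, h2, ?_⟩
    · rw [← hp, projGrad, neg_smul]
      abel
    -- On the eigenvector `ξ` of `lmin`, the form of `H` plus the multiplier equals `lmin * ‖ξ‖ ^
    -- 2`, and `H` contributes at least `l₁ * ‖ξ‖ ^ 2`.
    · rw [hform, shifted_apply, inner_sub_right, real_inner_smul_right,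
        real_inner_self_eq_norm_sq, real_inner_comm] at hval
      have h3 := hle ξ
      rw [Submodule.norm_coe] at hval h3
      refine le_of_mul_le_mul_right ?_ hξ2
      linarith
  · exact hz.exists_linear_rate hH hαbar hβ hσ hlim hn1 hp hlpos
      (hlpos.trans_le (hlmin.2 hlmax.1))
      (fun x hx => (hlmin' ⟨x, hmem x hx⟩).trans_eq (hform ⟨x, hmem x hx⟩))
      (fun x hx => (hform ⟨x, hmem x hx⟩).symm.trans_le (hlmax' ⟨x, hmem x hx⟩)) hr.1
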